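/- Work with untyped $\lambda$-terms modulo renaming of bound variables. $\to$ is one-step $\beta$-reduction and $\twoheadrightarrow$ its reflexive and transitive closure. Takahashi's translation is $x^*=x$, $((\lambda x.M)N)^*=M^*[x:=N^*]$, $(MN)^*=M^*N^*$ if $M$ is not an abstraction, $(\lambda x.M)^*=\lambda x.M^*$; and $M^{0*}=M$, $M^{(k+1)*}=(M^{k*})^*$. In a reduction path $M_0\to M_1\to\cdots\to M_n$ in which the step $M_i\to M_{i+1}$ contracts the redex occurrence $R_i$ of $M_i$, a redex occurrence of $M_{i+1}$ is called created if it is not a residual, with respect to the contraction of $R_i$, of any redex occurrence of $M_i$. The contracted redex $R_j$ is called new if, for some $1\le i\le j$, it is a residual (after the steps contracting $R_i,\dots,R_{j-1}$; for $i=j$ it is the redex itself) of a redex occurrence of $M_i$ created by the step $M_{i-1}\to M_i$. The path contains $k$ reductions of new redexes if exactly $k$ of the $R_0,\dots,R_{n-1}$ are new. **Theorem (Improved Church-Rosser theorem for $\beta$-reduction).** Let $P_n\leftarrow\cdots\leftarrow P_1\leftarrow M\to Q_1\to\cdots\to Q_m$ with $n,m\ge 0$ (where $P_0=Q_0=M$),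 and fix for each step the redex occurrence that it contracts. If the path $M\to P_1\to\cdots\to P_n$ contains $a$ reductions of new redexes and the path $M\to Q_1\to\cdots\to Q_m$ contains $b$ reductions of new redexes, then $$P_n\twoheadrightarrow Q_m^{(a+1)*}\qquad\text{and}\qquad Q_m\twoheadrightarrow P_n^{(b+1)*}.$$ -/

import Mathlib

namespace LambdaCalc

/-- Untyped `λ`-terms up to renaming of bound variables, in de Bruijn notation: `var i` is bound by
the `i`-th enclosing `lam` (counted from inside, from `0`) if there is one, and is a free variable
otherwise. -/
inductive Term : Type
  | var : ℕ → Term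
  | lam : Term → Term
  | app : Term → Term → Term

namespace Term

/-- Extension of a renaming under a binder. -/
def upRen (f : ℕ → ℕ) : ℕ → ℕ
  | 0 => 0
  | i + 1 => f i + 1

/-- Renaming of the free variables. -/
def rename : (ℕ → ℕ) → Term → Term
  | f, var i => var (f i)
  | f, lam s => lam (rename (upRen f) s)
  | f, app s t => app (rename f s) (rename f t)

/-- Extension of a substitution under a binder. -/
def upSubst (σ : ℕ → Term) : ℕ → Term
  | 0 => var 0
  | i + 1 => rename Nat.succ (σ i)

/-- Simultaneous capture-avoiding substitution for all free variables. -/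
def subst : (ℕ → Term) → Term → Term
  | σ, var i => σ i
  | σ, lam s => lam (subst (upSubst σ) s)
  | σ, app s t => app (subst σ s) (subst σ t)

/-- The substitution that sends variable `0` to `t` and lowers all other variables by one. -/
def single (t : Term) : ℕ → Term
  | 0 => t
  | i + 1 => var i

/-- `inst s t` is the contractum `s[x := t]` of the redex `(λ x. s) t`. -/
def inst (s t : Term) : Term := subst (single t) s

/-- Takahashi's translation `M*` (Gross–Knuth strategy). -/
def star : Term → Term
  | var i => var i
  | app (lam s) t => inst (star s) (star t)
  | app s t => app (star s) (star t)
  | lam s => lam (star s)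

/-- The iteration `M^{n*}` of the translation: `M^{0*} = M` and `M^{(n+1)*} = (M^{n*})*`. -/
def iterStar : ℕ → Term → Term
  | 0, M => M
  | n + 1, M => star (iterStar n M)

end Term

open Term

/-- One-step `β`-reduction. -/
inductive Beta : Term → Term → Prop
  | beta (s t : Term) : Beta (app (lam s) t) (inst s t)
  | lam {s s' : Term} : Beta s s' → Beta (lam s) (lam s')
  | appL {s s' : Term} (t : Term) : Beta s s' → Beta (app s t) (app s' t)
  | appR (s : Term) {t t' : Term} : Beta t t' → Beta (app s t) (app s t')

/-- Many-step `β`-reduction: the reflexive and transitive closure of `Beta`. -/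
def BetaStar : Term → Term → Prop := Relation.ReflTransGen Beta

/-- A direction in a term: to the body of an abstraction, or to the function part or the argument
part of an application. -/
inductive Dir : Type
  | body : Dir
  | fn : Dir
  | arg : Dir

/-- A position in a term, read from the root. Subterm occurrences are identified with positions;
`p <+: q` says that the occurrence at `q` is contained in the one at `p`. -/
abbrev Pos : Type := List Dir

/-- The subterm of a term at a position, if there is one. -/
def subtermAt : Term → Pos → Option Term
  | M, [] => some M
  | lam s, Dir.body :: p => subtermAt s p
  | app s _, Dir.fn :: p => subtermAt s p
  | app _ t, Dir.arg :: p => subtermAt t p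
  | _, _ :: _ => none

/-- The set of all redex occurrences in `M`. -/
def Redex (M : Term) : Set Pos := {p | ∃ s t : Term, subtermAt M p = some (app (lam s) t)}

/-- `Contract M p N`: the term `N` is obtained from `M` by contracting the redex occurrence `p`. -/
inductive Contract : Term → Pos → Term → Prop
  | beta (s t : Term) : Contract (app (lam s) t) [] (inst s t)
  | lam {s s' : Term} {p : Pos} : Contract s p s' → Contract (lam s) (Dir.body :: p) (lam s')
  | appL {s s' : Term} {p : Pos} (t : Term) :
      Contract s p s' → Contract (app s t) (Dir.fn :: p) (app s' t)
  | appR (s : Term) {t t' : Term} {p : Pos} :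
      Contract t p t' → Contract (app s t) (Dir.arg :: p) (app s t')

/-- `FreeAt k M u`: there is a free occurrence of the variable `k` in `M` at position `u`. -/
inductive FreeAt : ℕ → Term → Pos → Prop
  | var (k : ℕ) : FreeAt k (var k) []
  | lam {k : ℕ} {s : Term} {u : Pos} : FreeAt (k + 1) s u → FreeAt k (lam s) (Dir.body :: u)
  | appL {k : ℕ} {s : Term} (t : Term) {u : Pos} :
      FreeAt k s u → FreeAt k (app s t) (Dir.fn :: u)
  | appR {k : ℕ} (s : Term) {t : Term} {u : Pos} :
      FreeAt k t u → FreeAt k (app s t) (Dir.arg :: u)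

/-- `Residual M p q q'`: if the redex occurrence `p` of `M` is contracted, then the redex
occurrence `q` of `M` has the residual `q'` in the result. The redex `p` itself has none. -/
inductive Residual (M : Term) (p : Pos) : Pos → Pos → Prop
  /-- `q` and `p` are disjoint. -/
  | disjoint {q : Pos} : ¬ p <+: q → ¬ q <+: p → Residual M p q q
  /-- `q` properly contains `p`. -/
  | outside {q : Pos} : q <+: p → q ≠ p → Residual M p q q
  /-- `q` lies in the body `s` of the contracted redex `(λ x. s) t`, at position `r` of `s`;
  it becomes the subterm at position `r` of `s[x := t]`. -/
  | inBody (r : Pos) : Residual M p (p ++ Dir.fn :: Dir.body :: r) (p ++ r)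
  /-- `q` lies in the argument `t` of the contracted redex `(λ x. s) t`, at position `r` of `t`;
  it has one copy for every occurrence `u` of the bound variable `x` in `s`. -/
  | inArg {s t : Term} {u : Pos} (r : Pos) : subtermAt M p = some (app (lam s) t) →
      FreeAt 0 s u → Residual M p (p ++ Dir.arg :: r) (p ++ u ++ r)

/-- The set of residuals of a set `𝓡` of redex occurrences of `M` after contracting `p`. -/
def Res (M : Term) (p : Pos) (𝓡 : Set Pos) : Set Pos := {q' | ∃ q ∈ 𝓡, Residual M p q q'}

/-- `IsPath n M R`: the terms `M 0, …, M n` form a reduction path of length `n`, in which the step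
from `M i` to `M (i + 1)` contracts the redex occurrence `R i` (values beyond `n` play no role). -/
def IsPath (n : ℕ) (M : ℕ → Term) (R : ℕ → Pos) : Prop :=
  ∀ i < n, Contract (M i) (R i) (M (i + 1))

/-- The redex occurrences in `M i` that are created by the step from `M (i - 1)` to `M i`, that is,
are not residuals of redex occurrences in `M (i - 1)`; the initial term has none. -/
def NewRed (M : ℕ → Term) (R : ℕ → Pos) : ℕ → Set Pos
  | 0 => ∅
  | i + 1 => {q | q ∈ Redex (M (i + 1)) ∧ q ∉ Res (M i) (R i) (Redex (M i))}

/-- The residuals in `M (i + k)` of a set of redex occurrences in `M i`, after the `k` steps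
contracting `R i, …, R (i + k - 1)`. -/
def resAlong (M : ℕ → Term) (R : ℕ → Pos) (i : ℕ) (𝓡 : Set Pos) : ℕ → Set Pos
  | 0 => 𝓡
  | k + 1 => Res (M (i + k)) (R (i + k)) (resAlong M R i 𝓡 k)

/-- The redex `R j` contracted in `M j` is new: it is (a residual of) a redex occurrence that was
created at some `M i` with `i ≤ j`. -/
def IsNew (M : ℕ → Term) (R : ℕ → Pos) (j : ℕ) : Prop :=
  ∃ i k : ℕ, i + k = j ∧ R j ∈ resAlong M R i (NewRed M R i) k

/-- The number of steps of a path of length `n` that contract a new redex. -/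
noncomputable def newCount (n : ℕ) (M : ℕ → Term) (R : ℕ → Pos) : ℕ :=
  {j | j < n ∧ IsNew M R j}.ncard

end LambdaCalc

/-!
Let `X` be the set of residuals of the redexes of `M 0` along a path `M 0 → ⋯ → M n`. The invariant
is that the complete development of `X` in `M n` reduces to `(M 0)^{(k+1)*}`, where `k` counts the
new redexes contracted so far; at the start `X` consists of all redexes, and the development is
`(M 0)*`. A step contracting `p` replaces the development of `X` by that of `X ∪ {p}`. An old `p`
already lies in `X`, so nothing changes. A new `p` replaces the development by one of its parallel
reducts, which by Takahashi's triangle property costs one more application of `*`. Finally, `M n`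
reduces to each of its developments, and `M 0 ↠ N` implies `(M 0)^{(k+1)*} ↠ N^{(k+1)*}`.
-/

namespace LambdaCalc

namespace Term

theorem upSubst_comp_upRen (σ : ℕ → Term) (f : ℕ → ℕ) :
    upSubst σ ∘ upRen f = upSubst (σ ∘ f) := by
  funext i; cases i <;> rfl

theorem upSubst_var_comp (f : ℕ → ℕ) : upSubst (var ∘ f) = var ∘ upRen f := by
  funext i; cases i <;> rfl

theorem upSubst_var : upSubst var = var := by
  funext i; cases i <;> rfl

theorem rename_eq_subst (f : ℕ → ℕ) (s : Term) : rename f s = subst (var ∘ f) s := by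
  induction s generalizing f with
  | var i => rfl
  | lam s ih => simp only [rename, subst, upSubst_var_comp, ih]
  | app s t ihs iht => simp only [rename, subst, ihs, iht]

theorem subst_rename (σ : ℕ → Term) (f : ℕ → ℕ) (s : Term) :
    subst σ (rename f s) = subst (σ ∘ f) s := by
  induction s generalizing σ f with
  | var i => rfl
  | lam s ih => simp only [rename, subst, ih, upSubst_comp_upRen]
  | app s t ihs iht => simp only [rename, subst, ihs, iht]

theorem rename_rename (f g : ℕ → ℕ) (s : Term) : rename f (rename g s) = rename (f ∘ g) s := by
  simp only [rename_eq_subst f, rename_eq_subst (f ∘ g), subst_rename]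
  rfl

theorem rename_upRen_comp_upSubst (f : ℕ → ℕ) (σ : ℕ → Term) :
    rename (upRen f) ∘ upSubst σ = upSubst (rename f ∘ σ) := by
  funext i
  cases i with
  | zero => rfl
  | succ i => exact (rename_rename _ _ _).trans (rename_rename Nat.succ f _).symm

theorem rename_subst (f : ℕ → ℕ) (σ : ℕ → Term) (s : Term) :
    rename f (subst σ s) = subst (rename f ∘ σ) s := by
  induction s generalizing σ f with
  | var i => rfl
  | lam s ih => simp only [rename, subst, ih, rename_upRen_comp_upSubst]
  | app s t ihs iht => simp only [rename, subst, ihs, iht]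

theorem subst_upSubst_comp_upSubst (τ σ : ℕ → Term) :
    subst (upSubst τ) ∘ upSubst σ = upSubst (subst τ ∘ σ) := by
  funext i
  cases i with
  | zero => rfl
  | succ i => simp only [Function.comp_apply, upSubst, subst_rename, rename_subst]; rfl

theorem subst_subst (τ σ : ℕ → Term) (s : Term) :
    subst τ (subst σ s) = subst (subst τ ∘ σ) s := by
  induction s generalizing σ τ with
  | var i => rfl
  | lam s ih => simp only [subst, ih, subst_upSubst_comp_upSubst]
  | app s t ihs iht => simp only [subst, ihs, iht]

theorem subst_var (s : Term) : subst var s = s := by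
  induction s with
  | var i => rfl
  | lam s ih => simp only [subst, upSubst_var, ih]
  | app s t ihs iht => simp only [subst, ihs, iht]

theorem subst_inst (σ : ℕ → Term) (s t : Term) :
    subst σ (inst s t) = inst (subst (upSubst σ) s) (subst σ t) := by
  have single_comm : subst σ ∘ single t = subst (single (subst σ t)) ∘ upSubst σ := by
    funext i
    cases i with
    | zero => rfl
    | succ i => exact ((subst_rename (single _) Nat.succ (σ i)).trans (subst_var (σ i))).symm
  simp only [inst, subst_subst, single_comm]

theorem rename_inst (f : ℕ → ℕ) (s t : Term) :
    rename f (inst s t) = inst (rename (upRen f) s) (rename f t) := by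
  simp only [rename_eq_subst, subst_inst, upSubst_var_comp]

theorem upSubst_update (σ : ℕ → Term) (k : ℕ) (t : Term) :
    upSubst (Function.update σ k t) =
      Function.update (upSubst σ) (k + 1) (rename Nat.succ t) := by
  funext i
  cases i with
  | zero => rfl
  | succ i => by_cases h : i = k <;> simp [upSubst, h]

theorem update_single_zero (s t : Term) : Function.update (single s) 0 t = single t := by
  funext i; cases i <;> rfl

end Term

open Term

/-- Parallel `β`-reduction: any set of redexes already present in the term is contracted at
once. -/
inductive Par : Term → Term → Prop
  | var (i : ℕ) : Par (var i) (var i)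
  | lam {s s' : Term} : Par s s' → Par (lam s) (lam s')
  | app {s s' t t' : Term} : Par s s' → Par t t' → Par (app s t) (app s' t')
  | beta {s s' t t' : Term} : Par s s' → Par t t' → Par (app (lam s) t) (inst s' t')

namespace Par

theorem refl (s : Term) : Par s s := by
  induction s with
  | var i => exact .var i
  | lam s ih => exact .lam ih
  | app s t ihs iht => exact .app ihs iht

theorem rename {s s' : Term} (h : Par s s') (f : ℕ → ℕ) :
    Par (s.rename f) (s'.rename f) := by
  induction h generalizing f with
  | var i => exact .var (f i)
  | lam _ ih => exact .lam (ih (upRen f))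
  | app _ _ ihs iht => exact .app (ihs f) (iht f)
  | beta _ _ ihs iht => exact rename_inst .. ▸ .beta (ihs (upRen f)) (iht f)

theorem upSubst {σ τ : ℕ → Term} (h : ∀ i, Par (σ i) (τ i)) (i : ℕ) :
    Par (Term.upSubst σ i) (Term.upSubst τ i) := by
  cases i with
  | zero => exact .var 0
  | succ i => exact (h i).rename Nat.succ

theorem subst {s s' : Term} (h : Par s s') {σ τ : ℕ → Term} (hσ : ∀ i, Par (σ i) (τ i)) :
    Par (s.subst σ) (s'.subst τ) := by
  induction h generalizing σ τ with
  | var i => exact hσ i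
  | lam _ ih => exact .lam (ih (upSubst hσ))
  | app _ _ ihs iht => exact .app (ihs hσ) (iht hσ)
  | beta _ _ ihs iht => exact subst_inst .. ▸ .beta (ihs (upSubst hσ)) (iht hσ)

theorem inst {s s' t t' : Term} (hs : Par s s') (ht : Par t t') :
    Par (s.inst t) (s'.inst t') := by
  refine hs.subst fun i => ?_
  cases i with
  | zero => exact ht
  | succ i => exact .var i

theorem triangle {s s' : Term} (h : Par s s') : Par s' s.star := by
  induction h with
  | var i => exact .var i
  | lam _ ih => exact .lam ih
  | @app s _ t _ hs _ ihs iht =>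
    cases s with
    | var i => exact .app ihs iht
    | app u v => exact .app ihs iht
    | lam u =>
      cases hs
      cases ihs with
      | lam ihu => exact .beta ihu iht
  | beta _ _ ihs iht => exact ihs.inst iht

end Par

theorem Beta.par {s s' : Term} (h : Beta s s') : Par s s' := by
  induction h with
  | beta s t => exact .beta (.refl s) (.refl t)
  | lam _ ih => exact .lam ih
  | appL t _ ih => exact .app ih (.refl t)
  | appR s _ ih => exact .app (.refl s) ih

theorem BetaStar.lam {s s' : Term} (h : BetaStar s s') : BetaStar (.lam s) (.lam s') :=
  Relation.ReflTransGen.lift Term.lam (fun _ _ => Beta.lam) _ _ h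

theorem BetaStar.app {s s' t t' : Term} (hs : BetaStar s s') (ht : BetaStar t t') :
    BetaStar (.app s t) (.app s' t') :=
  (Relation.ReflTransGen.lift (Term.app · t) (fun _ _ => Beta.appL t) _ _ hs).trans
    (Relation.ReflTransGen.lift (Term.app s') (fun _ _ => Beta.appR s') _ _ ht)

theorem Par.betaStar {s s' : Term} (h : Par s s') : BetaStar s s' := by
  induction h with
  | var i => exact .refl
  | lam _ ih => exact ih.lam
  | app _ _ ihs iht => exact ihs.app iht
  | beta _ _ ihs iht => exact Relation.ReflTransGen.tail (ihs.lam.app iht) (.beta _ _)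

theorem BetaStar.star {s s' : Term} (h : BetaStar s s') : BetaStar s.star s'.star := by
  induction h with
  | refl => exact .refl
  | tail _ step ih => exact ih.trans step.par.triangle.triangle.betaStar

theorem BetaStar.iterStar {s s' : Term} (h : BetaStar s s') (k : ℕ) :
    BetaStar (s.iterStar k) (s'.iterStar k) := by
  induction k with
  | zero => exact h
  | succ k ih => exact ih.star

theorem Contract.beta_step {M N : Term} {p : Pos} (h : Contract M p N) : Beta M N := by
  induction h with
  | beta s t => exact .beta s t
  | lam _ ih => exact .lam ih
  | appL t _ ih => exact .appL t ih
  | appR s _ ih => exact .appR s ih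

theorem Contract.mem_redex {M N : Term} {p : Pos} (h : Contract M p N) : p ∈ Redex M := by
  induction h with
  | beta s t => exact ⟨s, t, rfl⟩
  | lam _ ih => exact ih
  | appL _ _ ih => exact ih
  | appR _ _ ih => exact ih

theorem exists_contract_of_mem_redex {M : Term} {p : Pos} (h : p ∈ Redex M) :
    ∃ N, Contract M p N := by
  obtain ⟨s, t, h⟩ := h
  fun_induction subtermAt M p with
  | case1 M => cases h; exact ⟨_, .beta s t⟩
  | case2 u p ih => exact (ih h).imp' _ fun _ => .lam
  | case3 u v p ih => exact (ih h).imp' _ fun _ => .appL v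
  | case4 u v p ih => exact (ih h).imp' _ fun _ => .appR u
  | case5 => cases h

theorem redex_var (i : ℕ) : Redex (var i) = ∅ :=
  Set.eq_empty_of_forall_notMem fun _ h =>
    have ⟨_, hN⟩ := exists_contract_of_mem_redex h
    nomatch hN

theorem exists_eq_lam_of_nil_mem_redex {s t : Term} (h : [] ∈ Redex (app s t)) :
    ∃ u, s = lam u := by
  obtain ⟨_, h⟩ := exists_contract_of_mem_redex h
  cases h
  exact ⟨_, rfl⟩

theorem Contract.subst {s s' : Term} {p : Pos} (h : Contract s p s') (σ : ℕ → Term) :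
    Contract (s.subst σ) p (s'.subst σ) := by
  induction h generalizing σ with
  | beta s t => exact subst_inst .. ▸ .beta _ _
  | lam _ ih => exact .lam (ih (upSubst σ))
  | appL _ _ ih => exact .appL _ (ih σ)
  | appR _ _ ih => exact .appR _ (ih σ)

theorem mem_redex_subst {s : Term} {p : Pos} (h : p ∈ Redex s) (σ : ℕ → Term) :
    p ∈ Redex (s.subst σ) :=
  have ⟨_, hs⟩ := exists_contract_of_mem_redex h
  (hs.subst σ).mem_redex

theorem FreeAt.append_mem_redex_subst {k : ℕ} {s : Term} {u r : Pos} {σ : ℕ → Term}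
    (hu : FreeAt k s u) (hr : r ∈ Redex (σ k)) : u ++ r ∈ Redex (s.subst σ) := by
  induction hu generalizing σ with
  | var k => exact hr
  | @lam k _ _ _ ih =>
    refine ih (σ := upSubst σ) ?_
    rw [upSubst, rename_eq_subst]
    exact mem_redex_subst hr _
  | appL _ _ ih => exact ih hr
  | appR _ _ ih => exact ih hr

/-- The positions of `X` that lie in the immediate subterm in direction `d`, read from the root of
that subterm. -/
def below (d : Dir) (X : Set Pos) : Set Pos := {p | d :: p ∈ X}

@[simp]
theorem mem_below {d : Dir} {X : Set Pos} {p : Pos} : p ∈ below d X ↔ d :: p ∈ X := Iff.rfl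

theorem below_mono {d : Dir} {X Y : Set Pos} (h : X ⊆ Y) : below d X ⊆ below d Y :=
  fun _ hp => h hp

theorem below_insert_nil (d : Dir) (X : Set Pos) : below d (insert [] X) = below d X := by
  ext; simp

theorem below_insert_cons (d : Dir) (p : Pos) (X : Set Pos) :
    below d (insert (d :: p) X) = insert p (below d X) := by
  ext; simp

theorem below_insert_cons_of_ne {d e : Dir} (h : e ≠ d) (p : Pos) (X : Set Pos) :
    below e (insert (d :: p) X) = below e X := by
  ext; simp [h]

namespace Term

open Classical in
/-- The result of the complete development of the redex occurrences of a term that belong to `X`: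
they are all contracted, innermost first. Positions in `X` that are not redex occurrences are
ignored. -/
noncomputable def develop : Set Pos → Term → Term
  | _, var i => var i
  | X, lam s => lam (develop (below .body X) s)
  | X, app (lam s) t =>
    if [] ∈ X then inst (develop (below .body (below .fn X)) s) (develop (below .arg X) t)
    else app (lam (develop (below .body (below .fn X)) s)) (develop (below .arg X) t)
  | X, app s t => app (develop (below .fn X) s) (develop (below .arg X) t)

theorem develop_app_lam {X : Set Pos} (h : [] ∈ X) (s t : Term) :
    develop X (app (lam s) t) =
      inst (develop (below .body (below .fn X)) s) (develop (below .arg X) t) :=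
  if_pos h

theorem develop_app {X : Set Pos} {s t : Term} (h : [] ∉ X ∩ Redex (app s t)) :
    develop X (app s t) = app (develop (below .fn X) s) (develop (below .arg X) t) := by
  cases s with
  | var i => rfl
  | app u v => rfl
  | lam u => exact if_neg fun hX => h ⟨hX, u, t, rfl⟩

theorem develop_app_congr {X Y : Set Pos} {s s' t t' : Term} (hX : X ⊆ Redex (app s t))
    (hY : Y ⊆ Redex (app s' t')) (hnil : [] ∈ X ↔ [] ∈ Y)
    (hs : develop (below .fn X) s = develop (below .fn Y) s')
    (ht : develop (below .arg X) t = develop (below .arg Y) t') :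
    develop X (app s t) = develop Y (app s' t') := by
  by_cases h : [] ∈ X
  · obtain ⟨u, rfl⟩ := exists_eq_lam_of_nil_mem_redex (hX h)
    obtain ⟨u', rfl⟩ := exists_eq_lam_of_nil_mem_redex (hY (hnil.mp h))
    rw [develop_app_lam h, develop_app_lam (hnil.mp h), lam.inj hs, ht]
  · rw [develop_app fun h' => h h'.1, develop_app fun h' => h (hnil.mpr h'.1), hs, ht]

theorem par_develop_develop {X Y : Set Pos} (h : X ⊆ Y) (s : Term) :
    Par (develop X s) (develop Y s) := by
  fun_induction develop X s generalizing Y with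
  | case1 X i => exact .var i
  | case2 X s ih => exact .lam (ih (below_mono h))
  | case3 X s t hX ihs iht =>
    rw [develop_app_lam (h hX)]
    exact (ihs (below_mono (below_mono h))).inst (iht (below_mono h))
  | case4 X s t _ ihs iht =>
    have ihs := ihs (below_mono (below_mono h))
    have iht := iht (below_mono h)
    by_cases hY : [] ∈ Y
    · rw [develop_app_lam hY]
      exact .beta ihs iht
    · rw [develop_app fun h => hY h.1]
      exact .app (.lam ihs) iht
  | case5 X s t hs ihs iht =>
    rw [develop_app fun h => (exists_eq_lam_of_nil_mem_redex h.2).elim hs]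
    exact .app (ihs (below_mono h)) (iht (below_mono h))

theorem develop_empty (s : Term) : develop ∅ s = s := by
  induction s with
  | var i => rfl
  | lam s ih => exact congrArg lam ih
  | app s t ihs iht => exact (develop_app fun h : [] ∈ ∅ ∩ _ => h.1).trans (congrArg₂ app ihs iht)

theorem develop_redex (s : Term) : develop (Redex s) s = star s := by
  fun_induction star s with
  | case1 i => rfl
  | case2 s t ihs iht =>
    rw [develop_app_lam (X := Redex _) ⟨s, t, rfl⟩]
    exact congrArg₂ inst ihs iht
  | case3 s t hs ihs iht =>
    rw [develop_app fun h => (exists_eq_lam_of_nil_mem_redex h.2).elim hs]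
    exact congrArg₂ app ihs iht
  | case4 s ih => exact congrArg lam ih

theorem develop_rename (X : Set Pos) (f : ℕ → ℕ) (s : Term) :
    develop X (rename f s) = rename f (develop X s) := by
  fun_induction develop X s generalizing f with
  | case1 X i => rfl
  | case2 X s ih => exact congrArg lam (ih _)
  | case3 X s t hX ihs iht =>
    rw [rename_inst, ← ihs, ← iht]
    exact develop_app_lam hX _ _
  | case4 X s t hX ihs iht =>
    rw [rename, rename, rename, rename, ← ihs, ← iht]
    exact develop_app fun h => hX h.1
  | case5 X s t hs ihs iht =>
    rw [rename, rename, ← ihs, ← iht]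
    refine develop_app fun h => ?_
    obtain ⟨u, hu⟩ := exists_eq_lam_of_nil_mem_redex h.2
    cases s with
    | lam s => exact hs s rfl
    | _ => cases hu

end Term

/-- The occurrences in `subst σ s` that come from the occurrences `X` in `s` or from the
occurrences `Y` in one of the copies of `σ k`. They depend on `k` and `s`, but not on `σ`. -/
def graft (k : ℕ) (s : Term) (X Y : Set Pos) : Set Pos :=
  X ∪ {q | ∃ u r, FreeAt k s u ∧ r ∈ Y ∧ u ++ r = q}

theorem graft_subset_redex {k : ℕ} {s : Term} {σ : ℕ → Term} {X Y : Set Pos}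
    (hX : X ⊆ Redex s) (hY : Y ⊆ Redex (σ k)) : graft k s X Y ⊆ Redex (s.subst σ) := by
  rintro _ (hq | ⟨u, r, hu, hr, rfl⟩)
  · exact mem_redex_subst (hX hq) σ
  · exact hu.append_mem_redex_subst (hY hr)

theorem graft_var_self (k : ℕ) (Y : Set Pos) : graft k (var k) ∅ Y = Y := by
  ext q
  constructor
  · rintro (hq | ⟨_, r, hu, hr, rfl⟩)
    · exact hq.elim
    · cases hu
      exact hr
  · exact fun hq => .inr ⟨[], q, .var k, hq, rfl⟩

theorem graft_var_of_ne {i k : ℕ} (h : i ≠ k) (Y : Set Pos) : graft k (var i) ∅ Y = ∅ := by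
  refine Set.eq_empty_of_forall_notMem ?_
  rintro _ (hq | ⟨_, _, hu, _⟩)
  · exact hq
  · cases hu
    exact h rfl

theorem below_body_graft (k : ℕ) (s : Term) (X Y : Set Pos) :
    below .body (graft k (lam s) X Y) = graft (k + 1) s (below .body X) Y := by
  ext q
  constructor
  · rintro (hq | ⟨_, r, hu, hr, hq⟩)
    · exact .inl hq
    · cases hu with
      | lam hu => exact .inr ⟨_, r, hu, hr, List.tail_eq_of_cons_eq hq⟩
  · rintro (hq | ⟨u, r, hu, hr, rfl⟩)
    · exact .inl hq
    · exact .inr ⟨_, r, .lam hu, hr, rfl⟩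

theorem below_fn_graft (k : ℕ) (s t : Term) (X Y : Set Pos) :
    below .fn (graft k (app s t) X Y) = graft k s (below .fn X) Y := by
  ext q
  constructor
  · rintro (hq | ⟨_, r, hu, hr, hq⟩)
    · exact .inl hq
    · cases hu with
      | appL _ hu => exact .inr ⟨_, r, hu, hr, List.tail_eq_of_cons_eq hq⟩
      | appR _ hu => cases hq
  · rintro (hq | ⟨u, r, hu, hr, rfl⟩)
    · exact .inl hq
    · exact .inr ⟨_, r, .appL t hu, hr, rfl⟩

theorem below_arg_graft (k : ℕ) (s t : Term) (X Y : Set Pos) :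
    below .arg (graft k (app s t) X Y) = graft k t (below .arg X) Y := by
  ext q
  constructor
  · rintro (hq | ⟨_, r, hu, hr, hq⟩)
    · exact .inl hq
    · cases hu with
      | appL _ hu => cases hq
      | appR _ hu => exact .inr ⟨_, r, hu, hr, List.tail_eq_of_cons_eq hq⟩
  · rintro (hq | ⟨u, r, hu, hr, rfl⟩)
    · exact .inl hq
    · exact .inr ⟨_, r, .appR s hu, hr, rfl⟩

theorem nil_mem_graft_app {k : ℕ} {s t : Term} {X Y : Set Pos} :
    [] ∈ graft k (app s t) X Y ↔ [] ∈ X := by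
  refine ⟨?_, .inl⟩
  rintro (h | ⟨_, _, hu, _, hq⟩)
  · exact h
  · cases hu <;> cases hq

namespace Term

theorem develop_subst {k : ℕ} {s : Term} {σ : ℕ → Term} {X Y : Set Pos} (hX : X ⊆ Redex s) :
    develop (graft k s X Y) (subst σ s) =
      subst (Function.update σ k (develop Y (σ k))) (develop X s) := by
  induction s generalizing k σ X with
  | var i =>
    obtain rfl : X = ∅ := Set.subset_empty_iff.mp (redex_var i ▸ hX)
    by_cases h : i = k
    · subst h
      simp only [graft_var_self, subst, develop, Function.update_self]
    · simp only [graft_var_of_ne h, subst, develop, develop_empty, Function.update_of_ne h]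
  | lam s ih =>
    have ih := ih (k := k + 1) (σ := upSubst σ) (X := below .body X) (below_mono hX)
    rw [upSubst, develop_rename] at ih
    simp only [subst, develop, below_body_graft, ih, upSubst_update]
  | app s t ihs iht =>
    have ihs := ihs (k := k) (σ := σ) (X := below .fn X) (below_mono hX)
    have iht := iht (k := k) (σ := σ) (X := below .arg X) (below_mono hX)
    by_cases h : [] ∈ X
    · obtain ⟨u, rfl⟩ := exists_eq_lam_of_nil_mem_redex (hX h)
      simp only [subst, develop, lam.injEq] at ihs
      rw [develop_app_lam h, subst_inst, ← ihs, ← iht, ← below_fn_graft, ← below_arg_graft]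
      exact develop_app_lam (nil_mem_graft_app.mpr h) _ _
    · rw [develop_app fun h' => h h'.1, subst, subst, ← ihs, ← iht, ← below_fn_graft,
        ← below_arg_graft]
      exact develop_app fun h' => h (nil_mem_graft_app.mp h'.1)

theorem develop_inst {s : Term} {X Y : Set Pos} (hX : X ⊆ Redex s) (t : Term) :
    develop (graft 0 s X Y) (inst s t) = inst (develop X s) (develop Y t) :=
  (develop_subst hX).trans (by rw [inst, single, update_single_zero])

end Term

theorem below_res {M N : Term} {d : Dir} {p : Pos} (h : subtermAt M (d :: p) = subtermAt N p)
    (X : Set Pos) : below d (Res M (d :: p) X) = Res N p (below d X) := by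
  ext q'
  constructor
  · rintro ⟨q, hq, hres⟩
    generalize hq' : d :: q' = w at hres
    cases hres with
    | disjoint hpq hqp =>
      cases hq'
      simp only [List.cons_prefix_cons, true_and] at hpq hqp
      exact ⟨q', hq, .disjoint hpq hqp⟩
    | outside hqp hne =>
      cases hq'
      exact ⟨q', hq, .outside (List.cons_prefix_cons.mp hqp).2 (ne_of_apply_ne (d :: ·) hne)⟩
    | inBody r =>
      cases hq'
      exact ⟨_, hq, .inBody r⟩
    | inArg r hM hu =>
      cases hq'
      exact ⟨_, hq, .inArg r (h ▸ hM) hu⟩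
  · rintro ⟨q, hq, hres⟩
    refine ⟨d :: q, hq, ?_⟩
    cases hres with
    | disjoint hpq hqp =>
      exact .disjoint (fun h => hpq (List.cons_prefix_cons.mp h).2)
        fun h => hqp (List.cons_prefix_cons.mp h).2
    | outside hqp hne =>
      exact .outside (List.cons_prefix_cons.mpr ⟨rfl, hqp⟩) fun h => hne (List.tail_eq_of_cons_eq h)
    | inBody r => exact .inBody (p := d :: p) r
    | inArg r hM hu => exact .inArg (p := d :: p) r (h.trans hM) hu

theorem below_res_of_ne {d e : Dir} (h : e ≠ d) (M : Term) (p : Pos) (X : Set Pos) :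
    below e (Res M (d :: p) X) = below e X := by
  ext q
  constructor
  · rintro ⟨q', hq', hres⟩
    generalize hq : e :: q = q at hres
    cases hres with
    | disjoint | outside =>
      cases hq
      exact hq'
    | inBody | inArg => exact absurd (List.head_eq_of_cons_eq hq) h
  · exact fun hq => ⟨e :: q, hq, .disjoint (by simp [h.symm]) (by simp [h])⟩

theorem mem_of_cons_mem_res_of_ne {M : Term} {d e : Dir} {p q : Pos} {X : Set Pos}
    (hq : e :: q ∈ Res M (d :: p) X) (h : e ≠ d) : e :: q ∈ X :=
  (below_res_of_ne h M p X).subset hq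

theorem nil_mem_res {M : Term} {d : Dir} {p : Pos} {X : Set Pos} :
    [] ∈ Res M (d :: p) X ↔ [] ∈ X := by
  constructor
  · rintro ⟨q, hq, hres⟩
    generalize hq' : ([] : Pos) = q' at hres
    cases hres with
    | disjoint | outside => exact hq' ▸ hq
    | inBody | inArg => cases hq'
  · exact fun h => ⟨[], h, .outside List.nil_prefix (List.cons_ne_nil d p).symm⟩

theorem res_nil (s t : Term) (X : Set Pos) :
    Res (app (lam s) t) [] X = graft 0 s (below .body (below .fn X)) (below .arg X) := by
  ext q'
  constructor
  · rintro ⟨q, hq, hres⟩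
    cases hres with
    | disjoint h _ => exact absurd List.nil_prefix h
    | outside h hne => exact absurd (List.prefix_nil.mp h) hne
    | inBody r => exact .inl hq
    | inArg r hM hu =>
      cases hM
      exact .inr ⟨_, r, hu, hq, rfl⟩
  · rintro (hq | ⟨u, r, hu, hr, rfl⟩)
    · exact ⟨_, hq, .inBody (p := []) q'⟩
    · exact ⟨_, hr, .inArg (p := []) r rfl hu⟩

theorem Contract.res_subset_redex {M N : Term} {p : Pos} (h : Contract M p N) {X : Set Pos}
    (hX : X ⊆ Redex M) : Res M p X ⊆ Redex N := by
  induction h generalizing X with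
  | beta s t =>
    rw [res_nil]
    exact graft_subset_redex (below_mono (below_mono hX)) (below_mono hX)
  | lam _ ih =>
    rintro (_ | ⟨_ | _ | _, q⟩) hq
    · obtain ⟨_, _, ⟨⟩⟩ := hX (nil_mem_res.mp hq)
    · exact ih (below_mono (d := .body) hX) ((below_res rfl X).subset hq)
    · exact hX (mem_of_cons_mem_res_of_ne hq nofun)
    · exact hX (mem_of_cons_mem_res_of_ne hq nofun)
  | appL _ hs ih =>
    rintro (_ | ⟨_ | _ | _, q⟩) hq
    · obtain ⟨_, rfl⟩ := exists_eq_lam_of_nil_mem_redex (hX (nil_mem_res.mp hq))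
      cases hs
      exact ⟨_, _, rfl⟩
    · exact hX (mem_of_cons_mem_res_of_ne hq nofun)
    · exact ih (below_mono (d := .fn) hX) ((below_res rfl X).subset hq)
    · exact hX (mem_of_cons_mem_res_of_ne hq nofun)
  | appR _ _ ih =>
    rintro (_ | ⟨_ | _ | _, q⟩) hq
    · obtain ⟨_, rfl⟩ := exists_eq_lam_of_nil_mem_redex (hX (nil_mem_res.mp hq))
      exact ⟨_, _, rfl⟩
    · exact hX (mem_of_cons_mem_res_of_ne hq nofun)
    · exact hX (mem_of_cons_mem_res_of_ne hq nofun)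
    · exact ih (below_mono (d := .arg) hX) ((below_res rfl X).subset hq)

theorem Contract.develop_res {M N : Term} {p : Pos} (h : Contract M p N) {X : Set Pos}
    (hX : X ⊆ Redex M) : develop (Res M p X) N = develop (insert p X) M := by
  induction h generalizing X with
  | beta s t =>
    rw [res_nil, develop_inst (below_mono (below_mono hX)),
      develop_app_lam (Set.mem_insert [] X), below_insert_nil, below_insert_nil]
  | lam _ ih =>
    rw [develop, develop, below_insert_cons, below_res rfl, ih (below_mono (d := .body) hX)]
  | appL t hs ih =>
    have hc := hs.appL t
    refine develop_app_congr (hc.res_subset_redex hX) (Set.insert_subset hc.mem_redex hX) ?_ ?_ ?_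
    · simp [nil_mem_res]
    · rw [below_insert_cons, below_res rfl, ih (below_mono (d := .fn) hX)]
    · rw [below_insert_cons_of_ne (d := .fn) (e := .arg) nofun,
        below_res_of_ne (d := .fn) (e := .arg) nofun]
  | appR s ht ih =>
    have hc := ht.appR s
    refine develop_app_congr (hc.res_subset_redex hX) (Set.insert_subset hc.mem_redex hX) ?_ ?_ ?_
    · simp [nil_mem_res]
    · rw [below_insert_cons_of_ne (d := .arg) (e := .fn) nofun,
        below_res_of_ne (d := .arg) (e := .fn) nofun]
    · rw [below_insert_cons, below_res rfl, ih (below_mono (d := .arg) hX)]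

section Path

variable {n : ℕ} {M : ℕ → Term} {R : ℕ → Pos}

theorem IsPath.of_succ (h : IsPath (n + 1) M R) : IsPath n M R :=
  fun i hi => h i (hi.trans n.lt_succ_self)

theorem IsPath.contract_last (h : IsPath (n + 1) M R) : Contract (M n) (R n) (M (n + 1)) :=
  h n n.lt_succ_self

theorem IsPath.betaStar (h : IsPath n M R) : BetaStar (M 0) (M n) := by
  induction n with
  | zero => exact .refl
  | succ n ih => exact .tail (ih h.of_succ) h.contract_last.beta_step

theorem resAlong_zero_succ (M : ℕ → Term) (R : ℕ → Pos) (X : Set Pos) (n : ℕ) :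
    resAlong M R 0 X (n + 1) = Res (M n) (R n) (resAlong M R 0 X n) := by
  rw [resAlong, Nat.zero_add]

theorem IsPath.resAlong_subset_redex (h : IsPath n M R) {X : Set Pos} (hX : X ⊆ Redex (M 0)) :
    resAlong M R 0 X n ⊆ Redex (M n) := by
  induction n with
  | zero => exact hX
  | succ n ih =>
    rw [resAlong_zero_succ]
    exact h.contract_last.res_subset_redex (ih h.of_succ)

theorem mem_resAlong_of_mem_redex {j : ℕ} {q : Pos} (hq : q ∈ Redex (M j)) :
    q ∈ resAlong M R 0 (Redex (M 0)) j ∨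
      ∃ i k, i + k = j ∧ q ∈ resAlong M R i (NewRed M R i) k := by
  induction j generalizing q with
  | zero => exact .inl hq
  | succ j ih =>
    by_cases hres : q ∈ Res (M j) (R j) (Redex (M j))
    · obtain ⟨q₀, hq₀, hr⟩ := hres
      rcases ih hq₀ with old | ⟨i, k, rfl, new⟩
      · exact .inl (resAlong_zero_succ M R _ j ▸ ⟨q₀, old, hr⟩)
      · exact .inr ⟨i, k + 1, rfl, q₀, new, hr⟩
    · exact .inr ⟨j + 1, 0, rfl, hq, hres⟩

open Classical in
theorem newCount_eq_count (n : ℕ) (M : ℕ → Term) (R : ℕ → Pos) :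
    newCount n M R = Nat.count (IsNew M R) n := by
  rw [newCount, Nat.count_eq_card_filter_range, ← Set.ncard_coe_finset]
  simp

theorem IsPath.betaStar_develop_resAlong (h : IsPath n M R) :
    BetaStar (develop (resAlong M R 0 (Redex (M 0)) n) (M n))
      (iterStar (newCount n M R + 1) (M 0)) := by
  classical
  simp only [newCount_eq_count]
  induction n with
  | zero => exact develop_redex (M 0) ▸ .refl
  | succ n ih =>
    have ih := ih h.of_succ
    have residuals := h.of_succ.resAlong_subset_redex subset_rfl
    have step := h.contract_last
    rw [resAlong_zero_succ, step.develop_res residuals, Nat.count_succ]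
    split_ifs with new
    · exact (par_develop_develop (Set.subset_insert _ _) _).triangle.betaStar.trans ih.star
    · have old := (mem_resAlong_of_mem_redex step.mem_redex).resolve_right new
      rwa [Set.insert_eq_of_mem old]

theorem IsPath.betaStar_iterStar {N : Term} (h : IsPath n M R) (hN : BetaStar (M 0) N) :
    BetaStar (M n) (iterStar (newCount n M R + 1) N) := by
  have hdev := par_develop_develop (Set.empty_subset (resAlong M R 0 (Redex (M 0)) n)) (M n)
  rw [develop_empty] at hdev
  exact (hdev.betaStar.trans h.betaStar_develop_resAlong).trans (hN.iterStar _)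

end Path

end LambdaCalc

theorem theorem2 (M : LambdaCalc.Term) (n m : ℕ)
    (P : ℕ → LambdaCalc.Term) (R : ℕ → LambdaCalc.Pos)
    (hP0 : P 0 = M) (hP : LambdaCalc.IsPath n P R)
    (Q : ℕ → LambdaCalc.Term) (S : ℕ → LambdaCalc.Pos)
    (hQ0 : Q 0 = M) (hQ : LambdaCalc.IsPath m Q S)
    (a b : ℕ)
    (ha : LambdaCalc.newCount n P R = a) (hb : LambdaCalc.newCount m Q S = b) :
    LambdaCalc.BetaStar (P n) (LambdaCalc.Term.iterStar (a + 1) (Q m)) ∧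
    LambdaCalc.BetaStar (Q m) (LambdaCalc.Term.iterStar (b + 1) (P n)) := by
  subst ha hb
  exact ⟨hP.betaStar_iterStar (hP0 ▸ hQ0 ▸ hQ.betaStar),
    hQ.betaStar_iterStar (hQ0 ▸ hP0 ▸ hP.betaStar)⟩
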